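/- **Setting.** Let $Z(t)=e^{i\vartheta(t)}\zeta\left(\tfrac12+it\right)$, $\vartheta(t)=-\tfrac t2\ln\pi+\operatorname{Im}\ln\Gamma\left(\tfrac14+\tfrac{it}{2}\right)$. Let $y_0>1$ and let $\mu$ be an admissible function on $[y_0,\infty)$, i.e. a continuously differentiable nondecreasing real function with $\mu(y)\ge 7y\ln y$ for $y\ge y_0$. Put $$\Phi(y)=\int_0^{\mu(y)}Z^2(t)e^{-\frac{2}{y}t}\,dt\qquad(y\ge y_0),$$ and let $\varphi(T)\in[y_0,\infty)$ be the solution of $$\Phi(\varphi(T))=\int_0^{T}Z^2(t)\,dt ,$$ defined for those $T$ for which there is exactly one solution. The function $\varphi_1=\tfrac12\varphi$ is the Jacob's ladder generated by $\mu$; put $$\tilde Z^2(t)=\frac{Z^2(t)}{2\Phi'(\varphi(t))} .$$ Let $\varphi_1^r$ be the $r$-fold iterate of $\varphi_1$ ($\varphi_1^0(t)=t$), and for $x$ large let $\overset{0}{x}=x$ and let the reverse iterates $\overset{1}{x},\overset{2}{x},\dots$ be given by $\varphi_1(\overset{j}{x})=\overset{j-1}{x}$; the $j$-th reverse iterate of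 $x+g$ is written $\overset{j}{\wideparen{x+g}}$. **Theorem 2.** For every fixed $g\in(0,\infty)$ and $k_0\in\mathbb N$, $k_0\ge2$, there is a $T_0>0$ such that for every $T>T_0$ and every $k$ with $2\le k\le k_0$ all the following integrals are well defined (the reverse iterates in them exist and are unique, the lower limit is smaller than the upper limit, all values $\varphi_1^r(t)$ in the integrand lie in the domain of $\varphi_1$, and the integrand is integrable), and $$\int_{\overset{p}{T}}^{\overset{p}{\wideparen{T+g}}}\prod_{r=0}^{p-1}\tilde Z^2[\varphi_1^r(t)]\,dt=g,\qquad p=1,\dots,k,$$ $$\int_{\overset{p}{T}}^{\overset{s}{\wideparen{\overset{p-s}{T}+g}}}\prod_{r=0}^{s-1}\tilde Z^2[\varphi_1^r(t)]\,dt=g,\qquad s=1,\dots,p-1,\quad p=2,\dots,k .$$ That is, in the triangular array whose $p$-th row ($1\le p\le k$) consists of the first (non-local) integral followed by the $p-1$ integrals of the second (local) kind with $s=1,\dots,p-1$, all entries are equal to $g$. -/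

import Mathlib

open MeasureTheory Set

noncomputable section

namespace JacobLadder

/-- The phase `ϑ(t) = -(t/2) ln π + Im ln Γ(1/4 + i t/2)`. The branch of `ln Γ` matters only modulo
`2π`, and `ϑ` is used only through `e^{iϑ(t)}`. -/
def theta (t : ℝ) : ℝ :=
  -(t / 2) * Real.log Real.pi + (Complex.log (Complex.Gamma (1 / 4 + Complex.I * (t / 2)))).im

/-- The real function `Z(t) = e^{iϑ(t)} ζ(1/2 + it)`; that the right-hand side is real is
`coe_hardyZ` below. -/
def hardyZ (t : ℝ) : ℝ :=
  (Complex.exp (Complex.I * theta t) * riemannZeta (1 / 2 + Complex.I * t)).re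

theorem coe_hardyZ (t : ℝ) :
    (hardyZ t : ℂ) = Complex.exp (Complex.I * theta t) * riemannZeta (1 / 2 + Complex.I * t) := by
  have hc0 : (1 / 2 + Complex.I * t : ℂ) ≠ 0 := by
    intro h
    have := congrArg Complex.re h
    simp at this
  have hconj : (starRingEnd ℂ) (1 / 2 + Complex.I * t : ℂ) = 1 - (1 / 2 + Complex.I * t) := by
    apply Complex.ext <;> simp
    norm_num
  have hc1 : (1 - (1 / 2 + Complex.I * t) : ℂ) ≠ 0 := by
    intro h
    have := congrArg Complex.re h
    norm_num at this
  have hG : ∀ s : ℂ, 0 < s.re → Complex.Gammaℝ s * riemannZeta s = completedRiemannZeta s := by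
    intro s hs
    have h0 : s ≠ 0 := by
      rintro rfl
      simp at hs
    rw [riemannZeta_def_of_ne_zero h0, mul_div_cancel₀]
    exact Complex.Gammaℝ_ne_zero_of_re_pos hs
  have hre : 0 < (1 / 2 + Complex.I * t : ℂ).re := by simp
  have hre' : 0 < (1 - (1 / 2 + Complex.I * t) : ℂ).re := by norm_num
  have hGconj : ∀ s : ℂ, (starRingEnd ℂ) (Complex.Gammaℝ s)
      = Complex.Gammaℝ ((starRingEnd ℂ) s) := by
    intro s
    have hp : ((Real.pi : ℂ)).arg ≠ Real.pi := by
      rw [Complex.arg_ofReal_of_nonneg Real.pi_pos.le]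
      exact Real.pi_pos.ne
    have h2s : (starRingEnd ℂ) (-s / 2) = -(starRingEnd ℂ) s / 2 := by
      rw [map_div₀, map_neg, map_ofNat]
    rw [Complex.Gammaℝ_def, Complex.Gammaℝ_def, map_mul, ← Complex.Gamma_conj]
    congr 1
    · rw [← h2s, Complex.cpow_conj _ _ hp, Complex.conj_ofReal]
    · rw [map_div₀, map_ofNat]
  have hL : (starRingEnd ℂ) (completedRiemannZeta (1 / 2 + Complex.I * t))
      = completedRiemannZeta (1 / 2 + Complex.I * t) := by
    rw [← hG _ hre, map_mul, hGconj, ← riemannZeta_conj, hconj, hG _ hre', hG _ hre,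
      completedRiemannZeta_one_sub]
  have hGne : Complex.Gamma (1 / 4 + Complex.I * (t / 2)) ≠ 0 :=
    Complex.Gamma_ne_zero_of_re_pos (by simp)
  have hexp : Complex.exp (Complex.I * theta t)
      * ‖Complex.Gamma (1 / 4 + Complex.I * (t / 2))‖
      = Complex.exp ((1 / 4 : ℝ) * Real.log Real.pi)
        * Complex.Gammaℝ (1 / 2 + Complex.I * t) := by
    have h1 : Complex.Gammaℝ (1 / 2 + Complex.I * t)
        = Complex.exp (Real.log Real.pi * (-(1 / 2 + Complex.I * t) / 2))
          * Complex.Gamma (1 / 4 + Complex.I * (t / 2)) := by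
      rw [Complex.Gammaℝ_def, Complex.cpow_def_of_ne_zero (by exact_mod_cast Real.pi_ne_zero),
        Complex.ofReal_log Real.pi_pos.le]
      congr 2
      ring
    have h2 := Complex.norm_mul_exp_arg_mul_I (Complex.Gamma (1 / 4 + Complex.I * (t / 2)))
    rw [h1, theta, Complex.log_im]
    generalize Complex.Gamma (1 / 4 + Complex.I * (t / 2)) = G at h2
    have h3 : Complex.exp (Complex.I * (-(t / 2) * Real.log Real.pi + G.arg : ℝ))
        = Complex.exp ((1 / 4 : ℝ) * Real.log Real.pi)
          * Complex.exp (Real.log Real.pi * (-(1 / 2 + Complex.I * t) / 2))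
          * Complex.exp (G.arg * Complex.I) := by
      rw [← Complex.exp_add, ← Complex.exp_add]
      congr 1
      push_cast
      ring
    rw [h3]
    linear_combination (Complex.exp ((1 / 4 : ℝ) * Real.log Real.pi)
          * Complex.exp (Real.log Real.pi * (-(1 / 2 + Complex.I * t) / 2))) * h2
  have hn : (‖Complex.Gamma (1 / 4 + Complex.I * (t / 2))‖ : ℂ) ≠ 0 := by
    exact_mod_cast norm_ne_zero_iff.mpr hGne
  have key : Complex.exp (Complex.I * theta t) * riemannZeta (1 / 2 + Complex.I * t)
      = ((Real.exp ((1 / 4 : ℝ) * Real.log Real.pi)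
          / ‖Complex.Gamma (1 / 4 + Complex.I * (t / 2))‖ : ℝ) : ℂ)
        * completedRiemannZeta (1 / 2 + Complex.I * t) := by
    rw [← hG _ hre, eq_div_of_mul_eq hn hexp]
    push_cast
    ring
  rw [hardyZ]
  apply Complex.conj_eq_iff_re.mp
  rw [key, map_mul, hL, Complex.conj_ofReal]

theorem hardyZ_sq (t : ℝ) : hardyZ t ^ 2 = ‖riemannZeta (1 / 2 + Complex.I * t)‖ ^ 2 := by
  have h := congrArg norm (coe_hardyZ t)
  rw [norm_mul, mul_comm Complex.I (theta t : ℂ), Complex.norm_exp_ofReal_mul_I, one_mul,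
    Complex.norm_real] at h
  rw [← h, Real.norm_eq_abs, sq_abs]

/-- `μ` is an admissible function on the half-line `[y₀, ∞)`: continuously differentiable,
nondecreasing, and `μ(y) ≥ 7 y ln y` (so that `μ` increases to `+∞`). -/
structure IsAdmissible (μ : ℝ → ℝ) (y₀ : ℝ) : Prop where
  one_lt : 1 < y₀
  contDiffOn : ContDiffOn ℝ 1 μ (Ici y₀)
  monotoneOn : MonotoneOn μ (Ici y₀)
  le : ∀ y ∈ Ici y₀, 7 * y * Real.log y ≤ μ y

/-- `Φ(y) = ∫_0^{μ(y)} Z²(t) e^{-2t/y} dt`. -/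
def Phi (μ : ℝ → ℝ) (y : ℝ) : ℝ :=
  ∫ t in (0 : ℝ)..μ y, hardyZ t ^ 2 * Real.exp (-(2 / y) * t)

/-- `y` solves, at the point `T`, the integral equation
`∫_0^{μ(y)} Z²(t) e^{-2t/y} dt = ∫_0^T Z²(t) dt`. -/
def IsSolution (μ : ℝ → ℝ) (y₀ T y : ℝ) : Prop :=
  y₀ ≤ y ∧ Phi μ y = ∫ t in (0 : ℝ)..T, hardyZ t ^ 2

/-- The set of the points `T` at which the integral equation has exactly one solution. -/
def domain (μ : ℝ → ℝ) (y₀ : ℝ) : Set ℝ :=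
  {T | ∃! y, IsSolution μ y₀ T y}

/-- The solution `φ(T) = φ_μ(T)` of the integral equation (used on `domain μ y₀` only). -/
def phi (μ : ℝ → ℝ) (y₀ T : ℝ) : ℝ :=
  Classical.epsilon (IsSolution μ y₀ T)

/-- The Jacob's ladder `φ₁(T) = φ(T) / 2`. -/
def phi₁ (μ : ℝ → ℝ) (y₀ T : ℝ) : ℝ :=
  phi μ y₀ T / 2

/-- `Z̃²(t) = Z²(t) / (2 Φ'(φ(t)))`, where `Φ'` is the derivative of `Φ` on `[y₀, ∞)`
(one-sided at `y₀`). -/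
def tildeZsq (μ : ℝ → ℝ) (y₀ t : ℝ) : ℝ :=
  hardyZ t ^ 2 / (2 * derivWithin (Phi μ) (Ici y₀) (phi μ y₀ t))

/-- The `p`-th reverse iterate of `x`: the `p`-fold application to `x` of the inverse of the ladder
`φ₁` on its domain. -/
def revIter (μ : ℝ → ℝ) (y₀ : ℝ) (p : ℕ) (x : ℝ) : ℝ :=
  (Function.invFunOn (phi₁ μ y₀) (domain μ y₀))^[p] x

/-- The first `p` reverse iterates of `x` really exist and are unique: for each `j < p` the `j`-th
one has exactly one preimage under the ladder. -/
def HasRevIter (μ : ℝ → ℝ) (y₀ : ℝ) (p : ℕ) (x : ℝ) : Prop :=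
  ∀ j < p, ∃! t, t ∈ domain μ y₀ ∧ phi₁ μ y₀ t = revIter μ y₀ j x

/-- The integrand `∏_{r=0}^{s-1} Z̃²[φ₁^r(t)]`, where `φ₁^r` is the `r`-fold iterate of `φ₁`. -/
def signal (μ : ℝ → ℝ) (y₀ : ℝ) (s : ℕ) (t : ℝ) : ℝ :=
  ∏ r ∈ Finset.range s, tildeZsq μ y₀ ((phi₁ μ y₀)^[r] t)

/-- The reversely iterated integral (energy) with the endpoints `T^p` (the `p`-th reverse iterate
of `T`) and `(x + g)^s` (the `s`-th reverse iterate of `x + g`), where `x = T^{p-s}`, of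
`∏_{r=0}^{s-1} Z̃²[φ₁^r(t)]`. -/
def energy (μ : ℝ → ℝ) (y₀ : ℝ) (T g : ℝ) (p s : ℕ) : ℝ :=
  ∫ t in (revIter μ y₀ p T)..(revIter μ y₀ s (revIter μ y₀ (p - s) T + g)), signal μ y₀ s t

/-- The integral `energy μ y₀ T g p s` is meaningful: the reverse iterates at its endpoints exist
and are unique, the endpoints bound a nondegenerate segment, the iterates `φ₁^r(t)` in the integrand
stay in the domain of the ladder, and the integrand is integrable on the segment. -/
structure EnergyDefined (μ : ℝ → ℝ) (y₀ : ℝ) (T g : ℝ) (p s : ℕ) : Prop where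
  left : HasRevIter μ y₀ p T
  right : HasRevIter μ y₀ s (revIter μ y₀ (p - s) T + g)
  lt : revIter μ y₀ p T < revIter μ y₀ s (revIter μ y₀ (p - s) T + g)
  mem_domain : ∀ t ∈ Icc (revIter μ y₀ p T) (revIter μ y₀ s (revIter μ y₀ (p - s) T + g)),
    ∀ r < s, (phi₁ μ y₀)^[r] t ∈ domain μ y₀
  integrable : IntervalIntegrable (signal μ y₀ s) volume
    (revIter μ y₀ p T) (revIter μ y₀ s (revIter μ y₀ (p - s) T + g))

end JacobLadder

end

/-! ### The Mellin transform of the fractional part and `ζ` in the critical strip. -/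

section FractionalPart

open Filter Topology Complex

/-! Put I(T) = ∫_0^T Z². The ladder is φ₁ = ½ Φ⁻¹∘I, so φ₁' = Z²/(2Φ'(φ)) = Z̃², and by the chain
rule ∏_{r<s} Z̃²(φ₁^r) is the derivative of φ₁^s. Every integral in the array runs between the s-th
reverse iterates of x and x + g, where x is the (p-s)-th reverse iterate of T; the fundamental
theorem of calculus gives (x + g) - x = g (`integral_prod_iterate_of_inverse_iterate`).

What needs proof is that the ladder is a bijection of half-lines
(`IsAdmissible.exists_domain_eq_Ici`). Φ has positive derivative, I is strictly increasing because ζ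
vanishes on no segment of the critical line, and both tend to infinity. Hence φ₁ maps [a, ∞)
increasingly onto [y₀/2, ∞), where I(a) = Φ(y₀). Reverse iterates of T tend to infinity with T, so
for large T the finitely many needed exceed max(a, y₀/2).

The divergence of I is obtained without asymptotics (`not_integrable_hardyZ_sq`): on the critical
line -ζ(s)/s is a Mellin transform of {x}. If Z² were integrable, so would be ζ(s)/s, and Mellin
inversion would make {x} agree off the integers with a continuous function, contradicting its jump
at 1. -/

theorem isBigO_ofReal_fract_atTop :
    (fun x : ℝ ↦ ((Int.fract x : ℝ) : ℂ)) =O[atTop] (fun x : ℝ ↦ x ^ (-(0 : ℝ))) := by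
  refine Asymptotics.IsBigO.of_bound 1 (Eventually.of_forall fun x ↦ ?_)
  simp [abs_of_nonneg (Int.fract_nonneg x), (Int.fract_lt_one x).le]

theorem locallyIntegrable_ofReal_fract :
    LocallyIntegrable (fun x : ℝ ↦ ((Int.fract x : ℝ) : ℂ)) := by
  refine (locallyIntegrable_const (1 : ℝ)).mono ?_ (Eventually.of_forall fun x ↦ ?_)
  · exact (Complex.measurable_ofReal.comp measurable_fract).aestronglyMeasurable
  · simp [abs_of_nonneg (Int.fract_nonneg x), (Int.fract_lt_one x).le]

/-- Cutting off (0, 1] removes the constraint at 0, leaving a whole half-plane of holomorphy that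
reaches the region of the Dirichlet series; the uncut transform is used only in the strip -1 < Re s
< 0. -/
theorem differentiableAt_mellin_indicator_fract {s : ℂ} (hs : s.re < 0) :
    DifferentiableAt ℂ (mellin ((Ioi 1).indicator fun x : ℝ ↦ ((Int.fract x : ℝ) : ℂ))) s := by
  refine mellin_differentiableAt_of_isBigO_rpow (a := 0) (b := s.re - 1) ?_ ?_ hs ?_ (by linarith)
  · refine (LocallyIntegrable.indicator locallyIntegrable_ofReal_fract
      measurableSet_Ioi).locallyIntegrableOn _
  · refine isBigO_ofReal_fract_atTop.congr' ?_ EventuallyEq.rfl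
    filter_upwards [eventually_gt_atTop 1] with x hx
    rw [indicator_of_mem (mem_Ioi.mpr hx)]
  · refine (Asymptotics.isBigO_zero _ _).congr' ?_ EventuallyEq.rfl
    filter_upwards [mem_nhdsWithin_of_mem_nhds (Iio_mem_nhds (zero_lt_one' ℝ))] with x hx
    rw [indicator_of_notMem (by simpa using (mem_Iio.mp hx).le)]

theorem mellinConvergent_fract {s : ℂ} (h₀ : -1 < s.re) (h₁ : s.re < 0) :
    MellinConvergent (fun x : ℝ ↦ ((Int.fract x : ℝ) : ℂ)) s := by
  refine mellinConvergent_of_isBigO_rpow (a := 0) (b := -1)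
    (locallyIntegrable_ofReal_fract.locallyIntegrableOn _) isBigO_ofReal_fract_atTop h₁ ?_ h₀
  refine Asymptotics.IsBigO.of_bound 1 ?_
  filter_upwards [Ioo_mem_nhdsGT (zero_lt_one' ℝ)] with x hx
  rw [Int.fract_eq_self.mpr ⟨hx.1.le, hx.2⟩]
  simp

theorem integrableOn_cpow_mul_fract {s : ℂ} (hs : s.re < 0) :
    IntegrableOn (fun t : ℝ ↦ (t : ℂ) ^ (s - 1) * ((Int.fract t : ℝ) : ℂ)) (Ioi 1) := by
  have h := integrableOn_Ioi_cpow_of_lt (a := s - 1) (by simp; linarith) one_pos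
  refine Integrable.mono h ?_ (Eventually.of_forall fun x ↦ ?_)
  · exact h.aestronglyMeasurable.mul
      (Complex.measurable_ofReal.comp measurable_fract).aestronglyMeasurable
  · rw [norm_mul]
    refine mul_le_of_le_one_right (norm_nonneg _) ?_
    simp [abs_of_nonneg (Int.fract_nonneg x), (Int.fract_lt_one x).le]

theorem mellin_indicator_fract (s : ℂ) :
    mellin ((Ioi 1).indicator fun x : ℝ ↦ ((Int.fract x : ℝ) : ℂ)) s =
      ∫ t : ℝ in Ioi 1, (t : ℂ) ^ (s - 1) * ((Int.fract t : ℝ) : ℂ) := by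
  have : (fun t : ℝ ↦ (t : ℂ) ^ (s - 1) •
      ((Ioi 1).indicator fun x : ℝ ↦ ((Int.fract x : ℝ) : ℂ)) t) =
      (Ioi 1).indicator fun t : ℝ ↦ (t : ℂ) ^ (s - 1) * ((Int.fract t : ℝ) : ℂ) := by
    ext t
    by_cases ht : t ∈ Ioi (1 : ℝ) <;> simp [ht]
  rw [mellin, this, setIntegral_indicator measurableSet_Ioi,
    inter_eq_self_of_subset_right (Ioi_subset_Ioi zero_le_one)]

theorem mellin_fract {s : ℂ} (h₀ : -1 < s.re) (h₁ : s.re < 0) :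
    mellin (fun x : ℝ ↦ ((Int.fract x : ℝ) : ℂ)) s = 1 / (s + 1) +
      mellin ((Ioi 1).indicator fun x : ℝ ↦ ((Int.fract x : ℝ) : ℂ)) s := by
  have hs1 : s + 1 ≠ 0 := fun h ↦ by
    have := congrArg Complex.re h
    simp at this
    linarith
  have hint := mellinConvergent_fract h₀ h₁
  simp only [MellinConvergent, smul_eq_mul] at hint
  rw [mellin_indicator_fract, mellin, ← Ioc_union_Ioi_eq_Ioi (zero_le_one' ℝ)]
  simp only [smul_eq_mul]
  rw [setIntegral_union (Ioc_disjoint_Ioi le_rfl) measurableSet_Ioi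
    (hint.mono_set Ioc_subset_Ioi_self) (hint.mono_set (Ioi_subset_Ioi zero_le_one))]
  congr 1
  rw [← intervalIntegral.integral_of_le zero_le_one]
  calc _ = ∫ t : ℝ in (0 : ℝ)..1, (t : ℂ) ^ s := by
        -- The endpoint t = 1, where the fractional part drops to 0, has to be discarded.
        refine intervalIntegral.integral_congr_ae ?_
        filter_upwards [compl_mem_ae_iff.mpr (measure_singleton (1 : ℝ))] with t ht1 ht
        rw [uIoc_of_le zero_le_one] at ht
        have ht1' : t < 1 := lt_of_le_of_ne ht.2 (by simpa using ht1)
        have ht0 : (t : ℂ) ≠ 0 := by exact_mod_cast ht.1.ne'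
        rw [Int.fract_eq_self.mpr ⟨ht.1.le, ht1'⟩, cpow_sub _ _ ht0, cpow_one,
          div_mul_cancel₀ _ ht0]
    _ = 1 / (s + 1) := by
        rw [integral_cpow (Or.inl h₀)]
        simp [zero_cpow hs1]

/-- Abel summation gives ζ(s) = s ∫_1^∞ ⌊t⌋ t^{-s-1} dt. With ⌊t⌋ = t - {t}, the term t yields
s/(s-1) = 1 + 1/(s-1), whose polar part `riemannZeta₀` omits. -/
theorem riemannZeta₀_eq_of_one_lt_re {s : ℂ} (hs : 1 < s.re) :
    riemannZeta₀ s =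
      1 - s * mellin ((Ioi 1).indicator fun x : ℝ ↦ ((Int.fract x : ℝ) : ℂ)) (-s) := by
  have hs1 : s ≠ 1 := by
    rintro rfl
    simp at hs
  have hs0 : s - 1 ≠ 0 := sub_ne_zero.mpr hs1
  have hsum : ∀ n : ℕ, ∑ k ∈ Finset.Icc 1 n, (1 : ℕ → ℂ) k = n := by
    intro n
    simp
  have hz : riemannZeta s = s * ∫ t in Ioi (1 : ℝ), ((⌊t⌋₊ : ℕ) : ℂ) * t ^ (-(s + 1)) := by
    rw [← LSeries_one_eq_riemannZeta hs, LSeries_eq_mul_integral 1 zero_le_one hs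
      (LSeriesSummable_one_iff.mpr hs)]
    · simp only [hsum]
    · simp only [hsum]
      exact Asymptotics.IsBigO.of_bound 1 (Eventually.of_forall fun n ↦ by simp)
  have h₁ : (∫ t in Ioi (1 : ℝ), ((⌊t⌋₊ : ℕ) : ℂ) * t ^ (-(s + 1))) =
      (∫ t in Ioi (1 : ℝ), (t : ℂ) ^ (-s)) -
      ∫ t : ℝ in Ioi 1, (t : ℂ) ^ (-s - 1) * ((Int.fract t : ℝ) : ℂ) := by
    rw [← integral_sub (integrableOn_Ioi_cpow_of_lt (by simpa using hs) one_pos)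
      (integrableOn_cpow_mul_fract (by simp; linarith))]
    refine setIntegral_congr_fun measurableSet_Ioi fun t ht ↦ ?_
    have ht0 : (0 : ℝ) < t := one_pos.trans ht
    have htc : (t : ℂ) ≠ 0 := by exact_mod_cast ht0.ne'
    have hfl : ((⌊t⌋₊ : ℕ) : ℂ) = t - (Int.fract t : ℝ) := by
      have h1 : (⌊t⌋₊ : ℝ) = t - Int.fract t := by
        rw [natCast_floor_eq_intCast_floor ht0.le, Int.self_sub_fract]
      exact_mod_cast congrArg (fun x : ℝ ↦ (x : ℂ)) h1
    have hp : (t : ℂ) ^ (-s) = t ^ (-s - 1) * t := by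
      rw [cpow_sub _ _ htc, cpow_one, div_mul_cancel₀ _ htc]
    rw [hfl, hp, neg_add, ← sub_eq_add_neg]
    ring
  rw [riemannZeta₀, if_neg hs1, hz, h₁, mellin_indicator_fract,
    integral_Ioi_cpow_of_lt (by simpa using hs) one_pos]
  have hs0' : -s + 1 ≠ 0 := by
    rw [neg_add_eq_sub]
    exact sub_ne_zero.mpr hs1.symm
  simp only [ofReal_one, one_cpow]
  field_simp
  ring

/-- Both sides are analytic on Re s > 0 and agree near 2, so the identity theorem applies. -/
theorem riemannZeta₀_eq {s : ℂ} (hs : 0 < s.re) :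
    riemannZeta₀ s =
      1 - s * mellin ((Ioi 1).indicator fun x : ℝ ↦ ((Int.fract x : ℝ) : ℂ)) (-s) := by
  have hU : IsOpen {s : ℂ | 0 < s.re} := isOpen_lt continuous_const continuous_re
  have hd : DifferentiableOn ℂ (fun s : ℂ ↦
      1 - s * mellin ((Ioi 1).indicator fun x : ℝ ↦ ((Int.fract x : ℝ) : ℂ)) (-s))
      {s : ℂ | 0 < s.re} := by
    intro z hz
    have := (differentiableAt_mellin_indicator_fract (s := -z)
      (by simpa using hz)).comp z differentiableAt_id.neg
    exact (DifferentiableAt.const_sub (differentiableAt_id.mul this) 1).differentiableWithinAt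
  refine AnalyticOnNhd.eqOn_of_preconnected_of_eventuallyEq
    (differentiable_riemannZeta₀.differentiableOn.analyticOnNhd hU) (hd.analyticOnNhd hU)
    (convex_halfSpace_re_gt 0).isPreconnected (z₀ := 2) (by simp) ?_ hs
  filter_upwards [(isOpen_lt continuous_const continuous_re).mem_nhds
    (by simp : (1 : ℝ) < (2 : ℂ).re)] with z hz using riemannZeta₀_eq_of_one_lt_re hz

/-- In the critical strip, `ζ(s) = -s ∫_0^∞ {x} x^{-s-1} dx`. -/
theorem riemannZeta_eq_neg_mul_mellin_fract {s : ℂ} (h₀ : 0 < s.re) (h₁ : s.re < 1) :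
    riemannZeta s = -s * mellin (fun x : ℝ ↦ ((Int.fract x : ℝ) : ℂ)) (-s) := by
  have hs1 : s ≠ 1 := by
    rintro rfl
    simp at h₁
  have hs0 : s - 1 ≠ 0 := sub_ne_zero.mpr hs1
  have hs0' : -s + 1 ≠ 0 := by
    rw [neg_add_eq_sub]
    exact sub_ne_zero.mpr hs1.symm
  -- At -s the interval (0, 1] contributes 1/(1-s), and -s/(1-s) = 1 + 1/(s-1) absorbs both the pole
  -- and the constant.
  rw [riemannZeta_eq_inv_sub_add hs1, riemannZeta₀_eq h₀,
    mellin_fract (by simpa using h₁) (by simpa using h₀)]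
  field_simp
  ring

/-- Dominated convergence: the modulus of z^{-(σ+iy)} is z^{-σ}, independent of y, and stays below
x^{-σ} + 1 for z near x. -/
theorem continuousAt_mellinInv {σ : ℝ} {f : ℂ → ℂ} (hf : VerticalIntegrable f σ) {x : ℝ}
    (hx : 0 < x) : ContinuousAt (mellinInv σ f) x := by
  unfold mellinInv
  refine ContinuousAt.fun_const_smul ?_ (1 / (2 * Real.pi))
  have hc : ContinuousAt (fun x : ℝ ↦ x ^ (-σ)) x :=
    Real.continuousAt_rpow_const _ _ (Or.inl hx.ne')
  have hpos : ∀ᶠ z : ℝ in 𝓝 x, 0 < z := lt_mem_nhds hx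
  refine continuousAt_of_dominated (bound := fun y : ℝ ↦ (x ^ (-σ) + 1) * ‖f (σ + y * I)‖)
    ?_ ?_ (hf.norm.const_mul _) ?_
  · filter_upwards [hpos] with z hz
    have hzc : (z : ℂ) ≠ 0 := by exact_mod_cast hz.ne'
    have hcont : Continuous fun y : ℝ ↦ (z : ℂ) ^ (-(σ + y * I)) :=
      Continuous.const_cpow (by fun_prop) (Or.inl hzc)
    exact hcont.aestronglyMeasurable.smul hf.aestronglyMeasurable
  · filter_upwards [hpos, hc.eventually_lt continuousAt_const (lt_add_one (x ^ (-σ)))] with z hz hz'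
    refine Eventually.of_forall fun y ↦ ?_
    rw [norm_smul, norm_cpow_eq_rpow_re_of_pos hz]
    refine mul_le_mul_of_nonneg_right ?_ (norm_nonneg _)
    simpa using hz'.le
  · refine Eventually.of_forall fun y ↦ ?_
    exact (continuousAt_ofReal_cpow_const _ _ (Or.inr hx.ne')).smul continuousAt_const

/-- Otherwise the inverse transform is continuous at 1 and equals {x} on both sides, so the
one-sided limits 1 and 0 would coincide. -/
theorem not_verticalIntegrable_mellin_fract {σ : ℝ} (h₀ : -1 < σ) (h₁ : σ < 0) :
    ¬ VerticalIntegrable (mellin fun x : ℝ ↦ ((Int.fract x : ℝ) : ℂ)) σ := by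
  intro hv
  have hinv : ∀ x : ℝ, 0 < x → ContinuousAt (fun x : ℝ ↦ ((Int.fract x : ℝ) : ℂ)) x →
      mellinInv σ (mellin fun x : ℝ ↦ ((Int.fract x : ℝ) : ℂ)) x = (Int.fract x : ℝ) :=
    fun x hx hc ↦ mellinInv_mellin_eq σ _ hx
      (mellinConvergent_fract (by simpa using h₀) (by simpa using h₁)) hv hc
  have hleft : ∀ x ∈ Ioo (0 : ℝ) 1,
      mellinInv σ (mellin fun x : ℝ ↦ ((Int.fract x : ℝ) : ℂ)) x = (x : ℂ) := by
    intro x hx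
    rw [hinv x hx.1, Int.fract_eq_self.mpr ⟨hx.1.le, hx.2⟩]
    refine continuous_ofReal.continuousAt.congr ?_
    filter_upwards [Ioo_mem_nhds hx.1 hx.2] with y hy
    rw [Int.fract_eq_self.mpr ⟨hy.1.le, hy.2⟩]
  have hfr : ∀ x ∈ Ioo (1 : ℝ) 2, Int.fract x = x - 1 := fun x hx ↦ by
    rw [Int.fract_eq_iff]
    exact ⟨by linarith [hx.1], by linarith [hx.2], 1, by simp⟩
  have hright : ∀ x ∈ Ioo (1 : ℝ) 2,
      mellinInv σ (mellin fun x : ℝ ↦ ((Int.fract x : ℝ) : ℂ)) x = ((x - 1 : ℝ) : ℂ) := by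
    intro x hx
    rw [hinv x (by linarith [hx.1]), hfr x hx]
    refine (continuous_ofReal.comp (continuous_sub_right (1 : ℝ))).continuousAt.congr ?_
    · filter_upwards [Ioo_mem_nhds hx.1 hx.2] with y hy
      rw [hfr y hy]
      simp
  have hcont := continuousAt_mellinInv hv one_pos
  have hl : Tendsto (fun x : ℝ ↦ (x : ℂ)) (𝓝[<] (1 : ℝ)) (𝓝 ((1 : ℝ) : ℂ)) :=
    (continuous_ofReal.tendsto 1).mono_left nhdsWithin_le_nhds
  have hr : Tendsto (fun x : ℝ ↦ ((x - 1 : ℝ) : ℂ)) (𝓝[>] (1 : ℝ)) (𝓝 ((1 - 1 : ℝ) : ℂ)) :=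
    ((continuous_ofReal.comp (continuous_sub_right (1 : ℝ))).tendsto 1).mono_left
      nhdsWithin_le_nhds
  have el := tendsto_nhds_unique (hcont.mono_left nhdsWithin_le_nhds)
    (hl.congr' (by
      filter_upwards [Ioo_mem_nhdsLT (zero_lt_one' ℝ)] with x hx using (hleft x hx).symm))
  have er := tendsto_nhds_unique (hcont.mono_left nhdsWithin_le_nhds)
    (hr.congr' (by
      filter_upwards [Ioo_mem_nhdsGT (one_lt_two (α := ℝ))] with x hx using (hright x hx).symm))
  rw [el] at er
  norm_num at er

end FractionalPart

/-! ### Positivity and divergence of the mean square of `Z`. -/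

namespace JacobLadder

section MeanSquare

open Filter Topology Complex

theorem critical_ne_one (t : ℝ) : (1 / 2 + I * t : ℂ) ≠ 1 := by
  intro h
  have := congrArg Complex.re h
  norm_num at this

theorem continuous_riemannZeta_critical : Continuous fun t : ℝ ↦ riemannZeta (1 / 2 + I * t) := by
  refine continuous_iff_continuousAt.mpr fun t ↦ ?_
  have h := (differentiableAt_riemannZeta (critical_ne_one t)).continuousAt
  exact ContinuousAt.comp (f := fun t : ℝ ↦ (1 / 2 + I * t : ℂ)) h (by fun_prop)

theorem continuous_hardyZ_sq : Continuous fun t ↦ hardyZ t ^ 2 := by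
  simp only [hardyZ_sq]
  exact continuous_riemannZeta_critical.norm.pow 2

theorem hardyZ_sq_neg (t : ℝ) : hardyZ (-t) ^ 2 = hardyZ t ^ 2 := by
  have : (1 / 2 + I * ((-t : ℝ) : ℂ) : ℂ) = (starRingEnd ℂ) (1 / 2 + I * t) := by
    apply Complex.ext <;> simp
  rw [hardyZ_sq, hardyZ_sq, this, riemannZeta_conj, Complex.norm_conj]

/-- Zeros filling a segment accumulate, which would force ζ = 0 on the connected set ℂ \ {1},
contrary to ζ(2) ≠ 0. -/
theorem exists_hardyZ_sq_pos {a b : ℝ} (hab : a < b) : ∃ c ∈ Ioo a b, 0 < hardyZ c ^ 2 := by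
  by_contra! hcon
  have hz : ∀ t ∈ Ioo a b, riemannZeta (1 / 2 + I * t) = 0 := fun t ht ↦ by
    have h := le_antisymm (hcon t ht) (sq_nonneg _)
    rw [hardyZ_sq] at h
    simpa using h
  obtain ⟨c, hc⟩ := exists_between hab
  have htend : Tendsto (fun t : ℝ ↦ (1 / 2 + I * t : ℂ)) (𝓝[≠] c) (𝓝[≠] (1 / 2 + I * c)) := by
    refine tendsto_nhdsWithin_of_tendsto_nhds_of_eventually_within _ ?_ ?_
    · exact ((by fun_prop : Continuous fun t : ℝ ↦ (1 / 2 + I * t : ℂ)).tendsto c).mono_left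
        nhdsWithin_le_nhds
    · filter_upwards [self_mem_nhdsWithin] with t ht
      simpa using ht
  have hfreq : ∃ᶠ z in 𝓝[≠] (1 / 2 + I * c : ℂ), riemannZeta z = 0 := by
    refine htend.frequently (Eventually.frequently ?_)
    filter_upwards [mem_nhdsWithin_of_mem_nhds (Ioo_mem_nhds hc.1 hc.2)] with t ht using hz t ht
  have h2 := analyticOn_riemannZeta.eqOn_zero_of_preconnected_of_frequently_eq_zero
    (isConnected_compl_singleton_of_one_lt_rank (by simp) 1).isPreconnected
    (critical_ne_one c) hfreq (by norm_num : (2 : ℂ) ∈ ({1}ᶜ : Set ℂ))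
  exact riemannZeta_ne_zero_of_one_le_re (by norm_num) h2

theorem intervalIntegral_hardyZ_sq_mul_pos {a b : ℝ} (hab : a < b) {f : ℝ → ℝ}
    (hf : Continuous f) (hpos : ∀ t ∈ Ioc a b, 0 < f t) : 0 < ∫ t in a..b, hardyZ t ^ 2 * f t := by
  obtain ⟨c, hc, hc'⟩ := exists_hardyZ_sq_pos hab
  exact intervalIntegral.integral_pos hab (continuous_hardyZ_sq.mul hf).continuousOn
    (fun t ht ↦ mul_nonneg (sq_nonneg _) (hpos t ht).le)
    ⟨c, Ioo_subset_Icc_self hc, mul_pos hc' (hpos c (Ioo_subset_Ioc_self hc))⟩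

theorem strictMono_integral_hardyZ_sq : StrictMono fun T ↦ ∫ t in (0 : ℝ)..T, hardyZ t ^ 2 := by
  intro a b hab
  have h := intervalIntegral_hardyZ_sq_mul_pos hab continuous_const (fun _ _ ↦ one_pos)
  simp only [mul_one] at h
  rw [← intervalIntegral.integral_interval_sub_left (continuous_hardyZ_sq.intervalIntegrable 0 b)
    (continuous_hardyZ_sq.intervalIntegrable 0 a)] at h
  linarith

theorem not_integrable_hardyZ_sq : ¬ Integrable fun t ↦ hardyZ t ^ 2 := by
  intro hint
  refine not_verticalIntegrable_mellin_fract (σ := -(1 / 2)) (by norm_num) (by norm_num) ?_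
  have heq : ∀ y : ℝ, mellin (fun x : ℝ ↦ ((Int.fract x : ℝ) : ℂ)) (((-(1 / 2) : ℝ) : ℂ) + y * I) =
      -(1 / 2 + I * ((-y : ℝ) : ℂ))⁻¹ * riemannZeta (1 / 2 + I * ((-y : ℝ) : ℂ)) := by
    intro y
    have hne : (1 / 2 + I * ((-y : ℝ) : ℂ) : ℂ) ≠ 0 := by
      intro h
      have := congrArg Complex.re h
      norm_num at this
    rw [riemannZeta_eq_neg_mul_mellin_fract (by simp) (by norm_num)]
    rw [neg_mul, neg_mul, mul_neg, neg_neg, inv_mul_cancel_left₀ hne]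
    congr 1
    push_cast
    ring
  rw [VerticalIntegrable]
  simp only [heq]
  have hcont : Continuous fun y : ℝ ↦
      -(1 / 2 + I * ((-y : ℝ) : ℂ))⁻¹ * riemannZeta (1 / 2 + I * ((-y : ℝ) : ℂ)) := by
    refine Continuous.mul (Continuous.neg (Continuous.inv₀ (by fun_prop) fun y h ↦ ?_))
      (continuous_riemannZeta_critical.comp continuous_neg)
    have := congrArg Complex.re h
    norm_num at this
  -- From uv ≤ u² + v² with u = 1/|s|, v = |ζ(s)|, and 1/(1/4 + y²) ≤ 4/(1 + y²).
  have hbound : Integrable fun y : ℝ ↦ 4 * (1 + y ^ 2)⁻¹ + hardyZ y ^ 2 :=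
    (integrable_inv_one_add_sq.const_mul 4).add hint
  refine hbound.mono' hcont.aestronglyMeasurable (Eventually.of_forall fun y ↦ ?_)
  have h1 : ‖(1 / 2 + I * ((-y : ℝ) : ℂ) : ℂ)‖ ^ 2 = 1 / 4 + y ^ 2 := by
    rw [← normSq_eq_norm_sq, normSq_apply]
    simp
    ring
  have h2 : (‖(1 / 2 + I * ((-y : ℝ) : ℂ) : ℂ)‖⁻¹) ^ 2 ≤ 4 * (1 + y ^ 2)⁻¹ := by
    rw [inv_pow, h1, ← div_eq_mul_inv, inv_le_comm₀ (by positivity) (by positivity), inv_div]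
    linarith [sq_nonneg y]
  rw [norm_mul, norm_neg, norm_inv, ← hardyZ_sq_neg y, hardyZ_sq]
  nlinarith [two_mul_le_add_sq (‖(1 / 2 + I * ((-y : ℝ) : ℂ) : ℂ)‖⁻¹)
    ‖riemannZeta (1 / 2 + I * ((-y : ℝ) : ℂ))‖,
    mul_nonneg (inv_nonneg.mpr (norm_nonneg (1 / 2 + I * ((-y : ℝ) : ℂ) : ℂ)))
      (norm_nonneg (riemannZeta (1 / 2 + I * ((-y : ℝ) : ℂ))))]

/-- A bounded primitive would make Z² integrable on (0, ∞), hence on ℝ by evenness. -/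
theorem tendsto_integral_hardyZ_sq :
    Tendsto (fun T ↦ ∫ t in (0 : ℝ)..T, hardyZ t ^ 2) atTop atTop := by
  refine tendsto_atTop_atTop_of_monotone strictMono_integral_hardyZ_sq.monotone fun B ↦ ?_
  by_contra! hcon
  have hpos : IntegrableOn (fun t ↦ hardyZ t ^ 2) (Ioi 0) := by
    refine integrableOn_Ioi_of_intervalIntegral_norm_bounded (l := atTop) (b := id) B 0
      (fun i ↦ (continuous_hardyZ_sq.integrableOn_Icc).mono_set Ioc_subset_Icc_self) tendsto_id
      (Eventually.of_forall fun T ↦ ?_)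
    simpa using (hcon T).le
  have hneg : IntegrableOn (fun t ↦ hardyZ t ^ 2) (Iic 0) := by
    rw [integrableOn_Iic_iff_integrableOn_Iio]
    have := hpos.comp_neg
    simpa [hardyZ_sq_neg] using this
  refine not_integrable_hardyZ_sq ?_
  rw [← integrableOn_univ, ← Iic_union_Ioi (a := (0 : ℝ))]
  exact hneg.union hpos

end MeanSquare

end JacobLadder

/-! ### Increasing bijections of half-lines, their inverses and iterates. -/

section HalfLineInverse

open Filter Topology Function

variable {f : ℝ → ℝ} {a b : ℝ}

theorem invFunOn_Ici_mem (him : f '' Ici a = Ici b) {x : ℝ} (hx : b ≤ x) :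
    a ≤ invFunOn f (Ici a) x :=
  invFunOn_mem (s := Ici a) (f := f) (by rwa [← mem_Ici, ← him] at hx)

theorem apply_invFunOn_Ici (him : f '' Ici a = Ici b) {x : ℝ} (hx : b ≤ x) :
    f (invFunOn f (Ici a) x) = x :=
  invFunOn_eq (s := Ici a) (f := f) (by rwa [← mem_Ici, ← him] at hx)

theorem invFunOn_Ici_apply (hf : StrictMonoOn f (Ici a)) {t : ℝ} (ht : a ≤ t) :
    invFunOn f (Ici a) (f t) = t :=
  hf.injOn.leftInvOn_invFunOn ht

theorem strictMonoOn_invFunOn_Ici (hf : StrictMonoOn f (Ici a)) (him : f '' Ici a = Ici b) :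
    StrictMonoOn (invFunOn f (Ici a)) (Ici b) := by
  intro x hx y hy hxy
  rw [← hf.lt_iff_lt (invFunOn_Ici_mem him hx) (invFunOn_Ici_mem him hy),
    apply_invFunOn_Ici him hx, apply_invFunOn_Ici him hy]
  exact hxy

theorem image_invFunOn_Ici (hf : StrictMonoOn f (Ici a)) (him : f '' Ici a = Ici b) :
    invFunOn f (Ici a) '' Ici b = Ici a := by
  ext t
  constructor
  · rintro ⟨x, hx, rfl⟩
    exact invFunOn_Ici_mem him hx
  · intro ht
    exact ⟨f t, him ▸ mem_image_of_mem f ht, invFunOn_Ici_apply hf ht⟩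

theorem StrictMonoOn.apply_left_of_image_Ici (hf : StrictMonoOn f (Ici a))
    (him : f '' Ici a = Ici b) : f a = b := by
  have h₁ : b ≤ f a := by
    rw [← mem_Ici, ← him]
    exact mem_image_of_mem f self_mem_Ici
  have h₂ : f (invFunOn f (Ici a) b) = b := apply_invFunOn_Ici him le_rfl
  exact le_antisymm
    (h₂ ▸ hf.monotoneOn self_mem_Ici (invFunOn_Ici_mem him le_rfl) (invFunOn_Ici_mem him le_rfl)) h₁

/-- A monotone function whose image has no gap cannot jump. Applied to the inverse of Φ, this
supplies the continuity needed to differentiate it. -/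
theorem StrictMonoOn.continuousAt_of_image_Ici (hf : StrictMonoOn f (Ici a))
    (him : f '' Ici a = Ici b) {t : ℝ} (ht : a < t) : ContinuousAt f t := by
  refine hf.continuousAt_of_image_mem_nhds (Ici_mem_nhds ht) ?_
  rw [him]
  exact Ici_mem_nhds (hf.apply_left_of_image_Ici him ▸ hf self_mem_Ici ht.le ht)

theorem tendsto_invFunOn_Ici (hf : StrictMonoOn f (Ici a)) (him : f '' Ici a = Ici b) :
    Tendsto (invFunOn f (Ici a)) atTop atTop := by
  refine tendsto_atTop.mpr fun c ↦ ?_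
  have hmem : b ≤ f (max a c) := by
    rw [← mem_Ici, ← him]
    exact mem_image_of_mem f (le_max_left a c)
  filter_upwards [eventually_ge_atTop (f (max a c))] with x hx
  have h := (strictMonoOn_invFunOn_Ici hf him).monotoneOn hmem (hmem.trans hx) hx
  rw [invFunOn_Ici_apply hf (le_max_left a c)] at h
  exact (le_max_right a c).trans h

/-- If the first `s` iterates of `x` under the inverse of `f` stay in the range, so do those of any
larger point, and the order is preserved. -/
theorem iterate_invFunOn_Ici_lt (hf : StrictMonoOn f (Ici a)) (him : f '' Ici a = Ici b) {s : ℕ}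
    {x x' : ℝ} (hxx' : x < x') (hx : ∀ j ≤ s, max a b < (invFunOn f (Ici a))^[j] x) :
    ∀ j ≤ s, (invFunOn f (Ici a))^[j] x < (invFunOn f (Ici a))^[j] x' := by
  intro j hj
  induction j with
  | zero => simpa using hxx'
  | succ j ih =>
    have hlt := ih (by omega)
    have hb := (le_max_right a b).trans (hx j (by omega)).le
    rw [iterate_succ_apply', iterate_succ_apply']
    exact strictMonoOn_invFunOn_Ici hf him hb (hb.trans hlt.le) hlt

/-- Each application of `f` strips one inverse iterate from both endpoints. The bound by `max a b`
keeps every point both in the domain of `f` and in its range. -/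
theorem iterate_mem_Icc_iterate_invFunOn (hf : StrictMonoOn f (Ici a)) (him : f '' Ici a = Ici b)
    {s : ℕ} {x x' : ℝ} (hxx' : x < x') (hx : ∀ j ≤ s, max a b < (invFunOn f (Ici a))^[j] x)
    {t : ℝ} (ht : t ∈ Icc ((invFunOn f (Ici a))^[s] x) ((invFunOn f (Ici a))^[s] x')) :
    ∀ r ≤ s, f^[r] t ∈
      Icc ((invFunOn f (Ici a))^[s - r] x) ((invFunOn f (Ici a))^[s - r] x') := by
  intro r hr
  induction r with
  | zero => simpa using ht
  | succ r ih =>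
    have h := ih (by omega)
    obtain ⟨m, hm⟩ : ∃ m, s - r = m + 1 := ⟨s - r - 1, by omega⟩
    have hm' : s - (r + 1) = m := by omega
    have hlt := iterate_invFunOn_Ici_lt hf him hxx' hx
    have hxm : b ≤ (invFunOn f (Ici a))^[m] x := (le_max_right a b).trans (hx m (by omega)).le
    have hxm' := hxm.trans (hlt m (by omega)).le
    have ha := (le_max_left a b).trans (hx (m + 1) (by omega)).le
    rw [hm] at h
    have h1 := hf.monotoneOn ha (ha.trans h.1) h.1
    have h2 := hf.monotoneOn (ha.trans h.1) (ha.trans (hlt (m + 1) (by omega)).le) h.2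
    rw [iterate_succ_apply', apply_invFunOn_Ici him hxm] at h1
    rw [iterate_succ_apply', apply_invFunOn_Ici him hxm'] at h2
    rw [hm', iterate_succ_apply']
    exact ⟨h1, h2⟩

theorem iterate_iterate_invFunOn_Ici (him : f '' Ici a = Ici b) {s : ℕ} {x : ℝ}
    (hx : ∀ j ≤ s, b ≤ (invFunOn f (Ici a))^[j] x) :
    f^[s] ((invFunOn f (Ici a))^[s] x) = x := by
  induction s with
  | zero => rfl
  | succ s ih =>
    rw [iterate_succ_apply, iterate_succ_apply', apply_invFunOn_Ici him (hx s (by omega))]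
    exact ih fun j hj ↦ hx j (by omega)

theorem hasDerivAt_iterate_prod {w : ℝ → ℝ} {s : ℕ} {t : ℝ}
    (h : ∀ r < s, HasDerivAt f (w (f^[r] t)) (f^[r] t)) :
    HasDerivAt f^[s] (∏ r ∈ Finset.range s, w (f^[r] t)) t := by
  induction s with
  | zero => simpa using hasDerivAt_id t
  | succ s ih =>
    rw [iterate_succ', Finset.prod_range_succ, mul_comm]
    exact (h s (by omega)).comp t (ih fun r hr ↦ h r (by omega))

theorem integral_prod_iterate_of_inverse_iterate (hf : StrictMonoOn f (Ici a))
    (him : f '' Ici a = Ici b) {w : ℝ → ℝ} (hw : ∀ t, a < t → HasDerivAt f (w t) t)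
    (hw₀ : ∀ t, a < t → 0 ≤ w t) {s : ℕ} {x x' : ℝ} (hxx' : x < x')
    (hx : ∀ j ≤ s, max a b < (invFunOn f (Ici a))^[j] x) :
    IntervalIntegrable (fun t ↦ ∏ r ∈ Finset.range s, w (f^[r] t)) volume
        ((invFunOn f (Ici a))^[s] x) ((invFunOn f (Ici a))^[s] x') ∧
      ∫ t in ((invFunOn f (Ici a))^[s] x)..((invFunOn f (Ici a))^[s] x'),
        ∏ r ∈ Finset.range s, w (f^[r] t) = x' - x := by
  have hlt := iterate_invFunOn_Ici_lt hf him hxx' hx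
  have hgt : ∀ t ∈ Icc ((invFunOn f (Ici a))^[s] x) ((invFunOn f (Ici a))^[s] x'),
      ∀ r < s, a < f^[r] t := fun t ht r hr ↦
    ((le_max_left a b).trans_lt (hx (s - r) (by omega))).trans_le
      (iterate_mem_Icc_iterate_invFunOn hf him hxx' hx ht r hr.le).1
  have hder : ∀ t ∈ Icc ((invFunOn f (Ici a))^[s] x) ((invFunOn f (Ici a))^[s] x'),
      HasDerivAt f^[s] (∏ r ∈ Finset.range s, w (f^[r] t)) t := fun t ht ↦
    hasDerivAt_iterate_prod fun r hr ↦ hw _ (hgt t ht r hr)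
  have hle := (hlt s le_rfl).le
  have hint : IntervalIntegrable (fun t ↦ ∏ r ∈ Finset.range s, w (f^[r] t)) volume
      ((invFunOn f (Ici a))^[s] x) ((invFunOn f (Ici a))^[s] x') := by
    rw [intervalIntegrable_iff_integrableOn_Ioc_of_le hle]
    -- A nonnegative derivative is automatically integrable, so no continuity of `w`, and hence none
    -- of Φ', is required.
    exact intervalIntegral.integrableOn_deriv_of_nonneg
      (fun t ht ↦ (hder t ht).continuousAt.continuousWithinAt)
      (fun t ht ↦ hder t (Ioo_subset_Icc_self ht))
      (fun t ht ↦ Finset.prod_nonneg fun r hr ↦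
        hw₀ _ (hgt t (Ioo_subset_Icc_self ht) r (Finset.mem_range.mp hr)))
  refine ⟨hint, ?_⟩
  have hb : ∀ j ≤ s, b ≤ (invFunOn f (Ici a))^[j] x := fun j hj ↦
    (le_max_right a b).trans (hx j hj).le
  rw [intervalIntegral.integral_eq_sub_of_hasDerivAt
      (fun t ht ↦ hder t (by rwa [uIcc_of_le hle] at ht)) hint,
    iterate_iterate_invFunOn_Ici him hb,
    iterate_iterate_invFunOn_Ici him fun j hj ↦ (hb j hj).trans (hlt j hj).le]

theorem existsUnique_preimage_Ici (hf : StrictMonoOn f (Ici a)) (him : f '' Ici a = Ici b) {x : ℝ}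
    (hx : b ≤ x) : ∃! t, t ∈ Ici a ∧ f t = x :=
  ⟨invFunOn f (Ici a) x, ⟨invFunOn_Ici_mem him hx, apply_invFunOn_Ici him hx⟩,
    fun _ ht ↦ ht.2 ▸ (invFunOn_Ici_apply hf ht.1).symm⟩

end HalfLineInverse

/-! ### Differentiation with respect to a moving endpoint. -/

section MovingEndpoint

open Filter Topology Asymptotics

/-- The derivative of an integral with respect to a moving endpoint, at the point where the interval
of integration degenerates; the integrand may depend on the parameter. -/
theorem hasDerivWithinAt_integral_degenerate {k : ℝ → ℝ → ℝ} {μ : ℝ → ℝ} {μ' y : ℝ} {s : Set ℝ}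
    (hk : ContinuousAt (Function.uncurry k) (y, μ y)) (hki : ∀ z ∈ s, Continuous (k z))
    (hμ : HasDerivWithinAt μ μ' s y) :
    HasDerivWithinAt (fun z ↦ ∫ t in (μ y)..(μ z), k z t) (μ' * k y (μ y)) s y := by
  have hlin : HasDerivWithinAt (fun z ↦ (μ z - μ y) * k y (μ y)) (μ' * k y (μ y)) s y :=
    (hμ.sub_const _).mul_const _
  have hrem : HasDerivWithinAt
      (fun z ↦ (∫ t in (μ y)..(μ z), k z t) - (μ z - μ y) * k y (μ y)) 0 s y := by
    rw [hasDerivWithinAt_iff_isLittleO]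
    simp only [intervalIntegral.integral_same, sub_self, zero_mul, smul_zero, sub_zero]
    -- Near (y, μ y) the integrand is within ε of its value there, over an interval of length |μ z -
    -- μ y|; so the remainder is o(μ z - μ y), and μ z - μ y = O(z - y).
    refine IsLittleO.trans_isBigO (g := fun z ↦ μ z - μ y) ?_
      (hμ.isBigO_sub.comp_tendsto (tendsto_id.prodMk tendsto_const_pure))
    refine isLittleO_iff.mpr fun ε hε ↦ ?_
    obtain ⟨δ, hδ, hball⟩ := Metric.continuousAt_iff.mp hk ε hε
    have hclose : ∀ᶠ z in 𝓝[s] y, dist (μ z) (μ y) < δ :=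
      hμ.continuousWithinAt.tendsto.eventually (Metric.ball_mem_nhds _ hδ)
    filter_upwards [hclose, mem_nhdsWithin_of_mem_nhds (Metric.ball_mem_nhds y hδ),
      self_mem_nhdsWithin] with z hz hzy hzs
    have hsub : (∫ t in (μ y)..(μ z), k z t) - (μ z - μ y) * k y (μ y) =
        ∫ t in (μ y)..(μ z), (k z t - k y (μ y)) := by
      rw [intervalIntegral.integral_sub ((hki z hzs).intervalIntegrable _ _)
        intervalIntegrable_const]
      simp
    rw [hsub]
    refine intervalIntegral.norm_integral_le_of_norm_le_const fun t ht ↦ ?_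
    have htz : dist t (μ y) < δ := by
      refine lt_of_le_of_lt ?_ hz
      rw [Real.dist_eq, Real.dist_eq]
      exact abs_sub_left_of_mem_uIcc (uIoc_subset_uIcc ht)
    have := hball (x := (z, t)) (by
      rw [Prod.dist_eq]
      exact max_lt hzy htz)
    rw [Real.dist_eq] at this
    exact this.le
  have := hrem.add hlin
  rw [zero_add] at this
  exact this.congr_of_eventuallyEq (Eventually.of_forall fun z ↦ by simp) (by simp)

end MovingEndpoint

/-! ### The function Φ, the ladder and its reverse iterates. -/

namespace JacobLadder

section Ladder

open Filter Topology Function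

variable {μ : ℝ → ℝ} {y₀ : ℝ}

theorem IsAdmissible.pos_of_le (hμ : IsAdmissible μ y₀) {y : ℝ} (hy : y₀ ≤ y) : 0 < y :=
  zero_lt_one.trans (hμ.one_lt.trans_le hy)

theorem IsAdmissible.map_pos (hμ : IsAdmissible μ y₀) {y : ℝ} (hy : y₀ ≤ y) : 0 < μ y := by
  have h₀ := hμ.pos_of_le hy
  have h₁ := Real.log_pos (hμ.one_lt.trans_le hy)
  exact (by positivity : 0 < 7 * y * Real.log y).trans_le (hμ.le y hy)

theorem hasDerivAt_exp_neg_two_div_mul (t : ℝ) {z : ℝ} (hz : z ≠ 0) :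
    HasDerivAt (fun z ↦ hardyZ t ^ 2 * Real.exp (-(2 / z) * t))
      (hardyZ t ^ 2 * (Real.exp (-(2 / z) * t) * (2 / z ^ 2 * t))) z := by
  refine HasDerivAt.const_mul _ (HasDerivAt.exp (HasDerivAt.mul_const ?_ t))
  have := ((hasDerivAt_inv hz).const_mul 2).neg
  refine (this.congr_deriv ?_).congr_of_eventuallyEq (Eventually.of_forall fun x ↦ ?_)
  · field_simp
  · simp [div_eq_mul_inv]

theorem continuous_hardyZ_sq_mul_exp (z : ℝ) :
    Continuous fun t ↦ hardyZ t ^ 2 * Real.exp (-(2 / z) * t) :=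
  continuous_hardyZ_sq.mul (by fun_prop)

theorem hasDerivAt_integral_hardyZ_sq_mul_exp {m y : ℝ} (hm : 0 ≤ m) (hy : 0 < y) :
    HasDerivAt (fun z ↦ ∫ t in (0 : ℝ)..m, hardyZ t ^ 2 * Real.exp (-(2 / z) * t))
      (∫ t in (0 : ℝ)..m, hardyZ t ^ 2 * (Real.exp (-(2 / y) * t) * (2 / y ^ 2 * t))) y := by
  refine (intervalIntegral.hasDerivAt_integral_of_dominated_loc_of_deriv_le
    -- For z > y/2 and 0 < t ≤ m the exponential is at most 1 and 2t/z² is at most 2m/(y/2)².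
    (bound := fun t ↦ hardyZ t ^ 2 * (1 * (2 / (y / 2) ^ 2 * m)))
    (F := fun z t ↦ hardyZ t ^ 2 * Real.exp (-(2 / z) * t))
    (F' := fun z t ↦ hardyZ t ^ 2 * (Real.exp (-(2 / z) * t) * (2 / z ^ 2 * t)))
    (Ioi_mem_nhds (half_lt_self hy)) ?_ ?_ ?_ ?_ ?_ ?_).2
  · exact Eventually.of_forall fun z ↦ (continuous_hardyZ_sq_mul_exp z).aestronglyMeasurable
  · exact (continuous_hardyZ_sq_mul_exp y).intervalIntegrable _ _
  · exact (continuous_hardyZ_sq.mul (by fun_prop)).aestronglyMeasurable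
  · refine Eventually.of_forall fun t ht z hz ↦ ?_
    rw [uIoc_of_le hm] at ht
    have hz' : y / 2 < z := hz
    have hz0 : 0 < z := (half_pos hy).trans hz'
    have ht0 := ht.1
    rw [Real.norm_of_nonneg (by positivity)]
    have hexp : Real.exp (-(2 / z) * t) ≤ 1 := by
      rw [Real.exp_le_one_iff, neg_mul, neg_nonpos]
      positivity
    have htm := ht.2
    gcongr
  · exact (continuous_hardyZ_sq.mul continuous_const).intervalIntegrable _ _
  · refine Eventually.of_forall fun t _ z hz ↦ hasDerivAt_exp_neg_two_div_mul t ?_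
    exact ((half_pos hy).trans hz).ne'

/-- Splitting the integral at μ(y) separates the dependence on z: a fixed interval, differentiated
under the integral sign, and an interval degenerate at z = y. -/
theorem IsAdmissible.hasDerivWithinAt_Phi (hμ : IsAdmissible μ y₀) {y : ℝ} (hy : y₀ ≤ y) :
    HasDerivWithinAt (Phi μ)
      ((∫ t in (0 : ℝ)..μ y, hardyZ t ^ 2 * (Real.exp (-(2 / y) * t) * (2 / y ^ 2 * t))) +
        derivWithin μ (Ici y₀) y * (hardyZ (μ y) ^ 2 * Real.exp (-(2 / y) * μ y)))
      (Ici y₀) y := by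
  have h₁ := (hasDerivAt_integral_hardyZ_sq_mul_exp (hμ.map_pos hy).le
    (hμ.pos_of_le hy)).hasDerivWithinAt (s := Ici y₀)
  have h₂ := hasDerivWithinAt_integral_degenerate
    (k := fun z t ↦ hardyZ t ^ 2 * Real.exp (-(2 / z) * t)) (s := Ici y₀) (y := y) (μ := μ)
    ?_ (fun z _ ↦ continuous_hardyZ_sq_mul_exp z)
    ((hμ.contDiffOn.differentiableOn one_ne_zero) y hy).hasDerivWithinAt
  · refine (h₁.add h₂).congr_of_eventuallyEq (Eventually.of_forall fun z ↦ ?_) ?_ <;>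
    simp only [Phi, Pi.add_apply] <;>
    rw [intervalIntegral.integral_add_adjacent_intervals] <;>
    exact (continuous_hardyZ_sq_mul_exp _).intervalIntegrable _ _
  · have hy0 : (y, μ y).1 ≠ 0 := (hμ.pos_of_le hy).ne'
    have h1 : ContinuousAt (fun p : ℝ × ℝ ↦ hardyZ p.2 ^ 2) (y, μ y) :=
      (continuous_hardyZ_sq.comp continuous_snd).continuousAt
    have h2 : ContinuousAt (fun p : ℝ × ℝ ↦ Real.exp (-(2 / p.1) * p.2)) (y, μ y) :=
      Real.continuous_exp.continuousAt.comp
        (((continuousAt_const.div continuousAt_fst hy0).neg).mul continuousAt_snd)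
    exact h1.mul h2

/-- The integral term is strictly positive; the endpoint term is nonnegative because μ is
nondecreasing. -/
theorem IsAdmissible.derivWithin_Phi_pos (hμ : IsAdmissible μ y₀) {y : ℝ} (hy : y₀ ≤ y) :
    0 < derivWithin (Phi μ) (Ici y₀) y := by
  rw [(hμ.hasDerivWithinAt_Phi hy).derivWithin (uniqueDiffOn_Ici y₀ y hy)]
  refine add_pos_of_pos_of_nonneg ?_ (mul_nonneg hμ.monotoneOn.derivWithin_nonneg (by positivity))
  have hy0 := hμ.pos_of_le hy
  refine intervalIntegral_hardyZ_sq_mul_pos (hμ.map_pos hy) (by fun_prop) fun t ht ↦ ?_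
  have := ht.1
  positivity

theorem IsAdmissible.hasDerivAt_Phi (hμ : IsAdmissible μ y₀) {y : ℝ} (hy : y₀ < y) :
    HasDerivAt (Phi μ) (derivWithin (Phi μ) (Ici y₀) y) y :=
  (hμ.hasDerivWithinAt_Phi hy.le).differentiableWithinAt.hasDerivWithinAt.hasDerivAt
    (Ici_mem_nhds hy)

theorem IsAdmissible.continuousOn_Phi (hμ : IsAdmissible μ y₀) : ContinuousOn (Phi μ) (Ici y₀) :=
  fun _ hy ↦ (hμ.hasDerivWithinAt_Phi hy).continuousWithinAt

theorem IsAdmissible.strictMonoOn_Phi (hμ : IsAdmissible μ y₀) :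
    StrictMonoOn (Phi μ) (Ici y₀) := by
  refine strictMonoOn_of_deriv_pos (convex_Ici y₀) hμ.continuousOn_Phi fun y hy ↦ ?_
  rw [interior_Ici] at hy
  rw [(hμ.hasDerivAt_Phi hy).deriv]
  exact hμ.derivWithin_Phi_pos (mem_Ioi.mp hy).le

/-- For y ≥ e admissibility gives μ(y) ≥ y, and on [0, y] the weight is at least e^{-2}; hence Φ(y)
≥ e^{-2} I(y). -/
theorem IsAdmissible.tendsto_Phi (hμ : IsAdmissible μ y₀) : Tendsto (Phi μ) atTop atTop := by
  refine tendsto_atTop_mono' atTop ?_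
    (tendsto_integral_hardyZ_sq.atTop_mul_const (Real.exp_pos (-2)))
  filter_upwards [eventually_ge_atTop y₀, eventually_ge_atTop (Real.exp 1)] with y hy hye
  have hy0 := hμ.pos_of_le hy
  have hlog : 1 ≤ Real.log y := (Real.le_log_iff_exp_le hy0).mpr hye
  have hyμ : y ≤ μ y := le_trans (by nlinarith) (hμ.le y hy)
  calc (∫ t in (0 : ℝ)..y, hardyZ t ^ 2) * Real.exp (-2)
      = ∫ t in (0 : ℝ)..y, hardyZ t ^ 2 * Real.exp (-2) := by
        rw [intervalIntegral.integral_mul_const]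
    _ ≤ ∫ t in (0 : ℝ)..y, hardyZ t ^ 2 * Real.exp (-(2 / y) * t) := by
        refine intervalIntegral.integral_mono_on hy0.le
          ((continuous_hardyZ_sq.mul continuous_const).intervalIntegrable _ _)
          ((continuous_hardyZ_sq_mul_exp y).intervalIntegrable _ _) fun t ht ↦ ?_
        refine mul_le_mul_of_nonneg_left (Real.exp_le_exp.mpr ?_) (sq_nonneg _)
        rw [neg_mul, neg_le_neg_iff, div_mul_eq_mul_div, div_le_iff₀ hy0]
        linarith [ht.2]
    _ ≤ Phi μ y := by
        refine intervalIntegral.integral_mono_interval le_rfl hy0.le hyμ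
          (Eventually.of_forall fun t ↦ by positivity)
          ((continuous_hardyZ_sq_mul_exp y).intervalIntegrable _ _)

theorem IsAdmissible.image_Phi (hμ : IsAdmissible μ y₀) :
    Phi μ '' Ici y₀ = Ici (Phi μ y₀) := by
  refine Subset.antisymm ?_ fun v hv ↦ ?_
  · rintro _ ⟨y, hy, rfl⟩
    exact hμ.strictMonoOn_Phi.monotoneOn self_mem_Ici hy hy
  · obtain ⟨z, hz, hz₀⟩ :=
      ((hμ.tendsto_Phi.eventually_ge_atTop v).and (eventually_ge_atTop y₀)).exists
    obtain ⟨y, hy, rfl⟩ := intermediate_value_Icc hz₀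
      (hμ.continuousOn_Phi.mono Icc_subset_Ici_self) ⟨hv, hz⟩
    exact ⟨y, hy.1, rfl⟩

theorem IsAdmissible.exists_integral_eq (hμ : IsAdmissible μ y₀) {y : ℝ} (hy : y₀ ≤ y) :
    ∃ T, ∫ t in (0 : ℝ)..T, hardyZ t ^ 2 = Phi μ y := by
  have hpos : 0 ≤ Phi μ y :=
    intervalIntegral.integral_nonneg (hμ.map_pos hy).le fun t _ ↦ by positivity
  have hcont : Continuous fun T ↦ ∫ t in (0 : ℝ)..T, hardyZ t ^ 2 :=
    intervalIntegral.continuous_primitive (fun a b ↦ continuous_hardyZ_sq.intervalIntegrable a b) 0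
  obtain ⟨z, hz⟩ := (tendsto_integral_hardyZ_sq.eventually_ge_atTop (Phi μ y)).exists
  exact mem_range_of_exists_le_of_exists_ge hcont ⟨0, by simpa using hpos⟩ ⟨z, hz⟩

theorem phi_isSolution {T : ℝ} (hT : T ∈ domain μ y₀) : IsSolution μ y₀ T (phi μ y₀ T) :=
  Classical.epsilon_spec hT.exists

/-- The ladder is an increasing bijection between two half-lines, and its derivative at interior
points is `Z̃²`. -/
theorem IsAdmissible.exists_domain_eq_Ici (hμ : IsAdmissible μ y₀) :
    ∃ a, domain μ y₀ = Ici a ∧ StrictMonoOn (phi₁ μ y₀) (Ici a) ∧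
      phi₁ μ y₀ '' Ici a = Ici (y₀ / 2) ∧
      ∀ t, a < t → HasDerivAt (phi₁ μ y₀) (tildeZsq μ y₀ t) t ∧ 0 ≤ tildeZsq μ y₀ t := by
  -- The left end of the domain is determined by I(a) = Φ(y₀).
  obtain ⟨a, ha⟩ := hμ.exists_integral_eq le_rfl
  have hI := strictMono_integral_hardyZ_sq
  have hΦ := hμ.strictMonoOn_Phi
  have him := hμ.image_Phi
  have hΨ := strictMonoOn_invFunOn_Ici hΦ him
  have hIa : ∀ {T : ℝ}, a ≤ T → Phi μ y₀ ≤ ∫ t in (0 : ℝ)..T, hardyZ t ^ 2 := fun {T} hT ↦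
    ha ▸ hI.monotone hT
  have hdom : domain μ y₀ = Ici a := by
    ext T
    constructor
    · intro hT
      obtain ⟨y, ⟨hy, hyT⟩, -⟩ := hT
      have h : Phi μ y₀ ≤ Phi μ y := hΦ.monotoneOn self_mem_Ici hy hy
      rw [hyT, ← ha] at h
      exact hI.le_iff_le.mp h
    · intro hT
      refine ⟨_, ⟨invFunOn_Ici_mem him (hIa hT), apply_invFunOn_Ici him (hIa hT)⟩, ?_⟩
      rintro y ⟨hy, hyT⟩
      rw [← hyT, invFunOn_Ici_apply hΦ hy]
  have hphi : ∀ T, a ≤ T → phi μ y₀ T =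
      invFunOn (Phi μ) (Ici y₀) (∫ t in (0 : ℝ)..T, hardyZ t ^ 2) := fun T hT ↦ by
    have h := phi_isSolution (μ := μ) (y₀ := y₀) (T := T) (by rwa [hdom])
    rw [← h.2, invFunOn_Ici_apply hΦ h.1]
  have hmono : StrictMonoOn (phi₁ μ y₀) (Ici a) := by
    intro T hT T' hT' hlt
    have := hΨ (hIa hT) (hIa hT') (hI hlt)
    simp only [phi₁, hphi T hT, hphi T' hT']
    linarith
  refine ⟨a, hdom, hmono, ?_, fun t ht ↦ ?_⟩
  · refine Subset.antisymm ?_ fun v hv ↦ ?_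
    · rintro _ ⟨T, hT, rfl⟩
      have := (phi_isSolution (μ := μ) (y₀ := y₀) (T := T) (by rwa [hdom])).1
      simp only [phi₁, mem_Ici]
      linarith
    · have hv' : y₀ ≤ 2 * v := by linarith [mem_Ici.mp hv]
      obtain ⟨T, hT⟩ := hμ.exists_integral_eq hv'
      have haT : a ≤ T := by
        have h := hΦ.monotoneOn self_mem_Ici hv' hv'
        rw [← hT, ← ha] at h
        exact hI.le_iff_le.mp h
      refine ⟨T, haT, ?_⟩
      rw [phi₁, hphi T haT, hT, invFunOn_Ici_apply hΦ hv']
      ring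
  · have hlt : Phi μ y₀ < ∫ u in (0 : ℝ)..t, hardyZ u ^ 2 := ha ▸ hI ht
    have hyt : y₀ < phi μ y₀ t := by
      rw [hphi t ht.le]
      have := hΨ self_mem_Ici hlt.le hlt
      rwa [invFunOn_Ici_apply hΦ le_rfl] at this
    have hpos := hμ.derivWithin_Phi_pos hyt.le
    have hcont := hΨ.continuousAt_of_image_Ici (image_invFunOn_Ici hΦ him) hlt
    have hΦ' := hμ.hasDerivAt_Phi hyt
    rw [hphi t ht.le] at hΦ'
    -- Φ⁻¹ has derivative 1/Φ'(φ(t)) at I(t); composing with I' = Z² and halving gives Z̃².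
    have hΨ' := hΦ'.of_local_left_inverse hcont (by rw [← hphi t ht.le]; exact hpos.ne') (by
      filter_upwards [lt_mem_nhds hlt] with v hv using apply_invFunOn_Ici him hv.le)
    have hI' : HasDerivAt (fun T ↦ ∫ u in (0 : ℝ)..T, hardyZ u ^ 2) (hardyZ t ^ 2) t :=
      intervalIntegral.integral_hasDerivAt_right (continuous_hardyZ_sq.intervalIntegrable _ _)
        (continuous_hardyZ_sq.stronglyMeasurableAtFilter _ _) continuous_hardyZ_sq.continuousAt
    refine ⟨?_, by unfold tildeZsq; positivity⟩
    refine (((hΨ'.comp t hI').div_const 2).congr_deriv ?_).congr_of_eventuallyEq ?_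
    · rw [← hphi t ht.le, tildeZsq]
      field_simp
    · filter_upwards [lt_mem_nhds ht] with T hT
      simp [phi₁, hphi T hT.le]

/-- Between reverse iterates of the same order, all iterates of the ladder are defined and the
signal integrates to the length of the original segment. -/
theorem energy_of_iterates_large {a : ℝ} (hdom : domain μ y₀ = Ici a)
    (hmono : StrictMonoOn (phi₁ μ y₀) (Ici a)) (him : phi₁ μ y₀ '' Ici a = Ici (y₀ / 2))
    (hder : ∀ t, a < t → HasDerivAt (phi₁ μ y₀) (tildeZsq μ y₀ t) t ∧ 0 ≤ tildeZsq μ y₀ t)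
    {T g : ℝ} (hg : 0 < g) {p s : ℕ} (hsp : s ≤ p)
    (hT : ∀ j ≤ p, max a (y₀ / 2) < revIter μ y₀ j T) :
    EnergyDefined μ y₀ T g p s ∧ energy μ y₀ T g p s = g := by
  have hrev : ∀ j x, revIter μ y₀ j x = (invFunOn (phi₁ μ y₀) (Ici a))^[j] x := fun j x ↦ by
    rw [revIter, hdom]
  simp only [hrev] at hT
  -- The lower limit is itself the s-th reverse iterate of x, so local and non-local integrals
  -- become the same case.
  have hcomp : revIter μ y₀ p T =
      (invFunOn (phi₁ μ y₀) (Ici a))^[s] (revIter μ y₀ (p - s) T) := by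
    rw [hrev, hrev, ← iterate_add_apply, Nat.add_sub_cancel' hsp]
  set x := revIter μ y₀ (p - s) T with hx
  have hlarge : ∀ j ≤ s, max a (y₀ / 2) < (invFunOn (phi₁ μ y₀) (Ici a))^[j] x := fun j hj ↦ by
    rw [hx, hrev, ← iterate_add_apply]
    exact hT _ (by omega)
  have hxg : x < x + g := lt_add_of_pos_right x hg
  have hlt := iterate_invFunOn_Ici_lt hmono him hxg hlarge
  have hint := integral_prod_iterate_of_inverse_iterate hmono him (fun t ht ↦ (hder t ht).1)
    (fun t ht ↦ (hder t ht).2) hxg hlarge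
  refine ⟨⟨fun j hj ↦ ?_, fun j hj ↦ ?_, ?_, fun t ht r hr ↦ ?_, ?_⟩, ?_⟩
  · rw [hrev, hdom]
    exact existsUnique_preimage_Ici hmono him ((le_max_right _ _).trans (hT j hj.le).le)
  · rw [hrev, hdom]
    exact existsUnique_preimage_Ici hmono him
      ((le_max_right _ _).trans ((hlarge j hj.le).trans (hlt j hj.le)).le)
  · rw [hcomp, hrev]
    exact hlt s le_rfl
  · rw [hcomp, hrev] at ht
    rw [hdom]
    exact (le_max_left _ _).trans ((hlarge (s - r) (by omega)).le.trans
      (iterate_mem_Icc_iterate_invFunOn hmono him hxg hlarge ht r hr.le).1)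
  · rw [hcomp, hrev]
    exact hint.1
  · rw [energy, ← hx, hcomp, hrev s (x + g)]
    exact hint.2.trans (add_sub_cancel_left x g)

end Ladder

end JacobLadder

theorem theorem2 (μ : ℝ → ℝ) (y₀ : ℝ) (hμ : JacobLadder.IsAdmissible μ y₀)
    (g : ℝ) (hg : 0 < g) (k₀ : ℕ) (hk₀ : 2 ≤ k₀) :
    ∃ T₀ : ℝ, 0 < T₀ ∧ ∀ T : ℝ, T₀ < T → ∀ k : ℕ, 2 ≤ k → k ≤ k₀ →
      ∀ p : ℕ, 1 ≤ p → p ≤ k →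
        (JacobLadder.EnergyDefined μ y₀ T g p p ∧
          (∫ t in (JacobLadder.revIter μ y₀ p T)..(JacobLadder.revIter μ y₀ p (T + g)),
            JacobLadder.signal μ y₀ p t) = g) ∧
        ∀ s : ℕ, 1 ≤ s → s < p →
          JacobLadder.EnergyDefined μ y₀ T g p s ∧ JacobLadder.energy μ y₀ T g p s = g := by
  obtain ⟨a, hdom, hmono, him, hder⟩ := hμ.exists_domain_eq_Ici
  -- Each reverse iterate tends to infinity with T, and only the orders j ≤ k₀ occur, so one
  -- threshold serves them all.
  have hev : ∀ᶠ T in Filter.atTop, ∀ j ∈ Iic k₀,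
      max a (y₀ / 2) < JacobLadder.revIter μ y₀ j T := by
    refine (Filter.eventually_all_finite (finite_Iic k₀)).mpr fun j _ ↦ ?_
    have := (tendsto_invFunOn_Ici hmono him).iterate j
    rw [← hdom] at this
    exact this.eventually_gt_atTop _
  obtain ⟨T₁, hT₁⟩ := Filter.eventually_atTop.mp hev
  refine ⟨max 1 T₁, zero_lt_one.trans_le (le_max_left _ _), fun T hT k _ hk p _ hp ↦ ?_⟩
  have hlarge : ∀ j ≤ p, max a (y₀ / 2) < JacobLadder.revIter μ y₀ j T := fun j hj ↦
    hT₁ T ((le_max_right _ _).trans hT.le) j (hj.trans (hp.trans hk))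
  refine ⟨?_, fun s _ hs ↦
    JacobLadder.energy_of_iterates_large hdom hmono him hder hg hs.le hlarge⟩
  -- The non-local integral is the case s = p, where x is T itself.
  have h := JacobLadder.energy_of_iterates_large hdom hmono him hder hg le_rfl hlarge
  refine ⟨h.1, ?_⟩
  have h₂ := h.2
  rw [JacobLadder.energy, Nat.sub_self] at h₂
  exact h₂
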